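/- For an integer $k\ge 2$ let $P_k$ be the path of length $k$ (with $k+1$ vertices). Let $\mathcal G_{P_k}$ be the class of all countable (finite or countably infinite) simple graphs that have no subgraph, induced or not, isomorphic to $P_k$. Let $\mathcal E_{P_k}$ be the class of those $G\in\mathcal G_{P_k}$ that are existentially complete: for every $H\in\mathcal G_{P_k}$ containing $G$ as an induced subgraph, every existential first-order statement in the language of graphs, with parameters from $G$, that is true in $H$ is also true in $G$. For $G\in\mathcal E_{P_k}$ and $v\in V(G)$ let $\mathrm{acl}_G(v)$ be the set of all $a\in V(G)$ for which there is an existential formula $\phi(x,v)$ in the language of graphs such that $\{a'\in V(G): G\models\phi(a',v)\}$ is finite and contains $a$. Then the maximum $$c_k(1)=\max\{|\mathrm{acl}_G(v)| : G\in\mathcal E_{P_k},\ v\in V(G)\}$$ exists (in particular, all these sets $\mathrm{acl}_G(v)$ are finite), and $$c_k(1)<k^{3k^2}.$$ -/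

import Mathlib

open FirstOrder

namespace CFree

/-- A finite graph, on a vertex set of the form `{0, …, n - 1}`. Every finite graph is isomorphic
to one of these. -/
abbrev FinGraph : Type := Σ n : ℕ, SimpleGraph (Fin n)

/-- `G` omits `C`: no subgraph of `G`, induced or not, is isomorphic to a graph in `C`. -/
def Omits {V : Type} (G : SimpleGraph V) (C : Set FinGraph) : Prop :=
  ∀ F ∈ C, ¬ F.2.IsContained G

/-- The class of countable (finite or countably infinite) graphs omitting `C`. -/
def InG (C : Set FinGraph) {V : Type} (G : SimpleGraph V) : Prop :=
  Countable V ∧ Omits G C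

/-- Truth in the graph `G` of a first-order formula in the language of graphs (adjacency and
equality), where `v` gives the values of the free variables. -/
def Holds {V : Type} (G : SimpleGraph V) {α : Type} (φ : Language.graph.Formula α)
    (v : α → V) : Prop :=
  @Language.Formula.Realize Language.graph V G.structure α φ v

/-- `G` is existentially complete in `H`, where `G` is identified with an induced subgraph of `H`
by means of `f`: each existential statement with parameters from `G` that is true in `H` is true
in `G`. -/
def ExistentiallyCompleteIn {V W : Type} (G : SimpleGraph V) (H : SimpleGraph W)
    (f : G ↪g H) : Prop :=
  ∀ φ : Language.graph.Formula V, φ.IsExistential → Holds H φ f → Holds G φ id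

/-- The class of existentially complete graphs among the countable graphs omitting `C`. -/
def InE (C : Set FinGraph) {V : Type} (G : SimpleGraph V) : Prop :=
  InG C G ∧ ∀ (W : Type) (H : SimpleGraph W) (f : G ↪g H),
    InG C H → ExistentiallyCompleteIn G H f

/-- The solution set in `G` of the formula `φ(x, A)` with parameters from `A`. The parameters are
the free variables in the left summand, and `x` is the one in the right summand. -/
def solutions {V : Type} (G : SimpleGraph V) (A : Set V)
    (φ : Language.graph.Formula (A ⊕ Unit)) : Set V :=
  {b | Holds G φ (Sum.elim (fun a : A => (a : V)) (fun _ => b))}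

/-- The algebraic closure of `A` in `G`: the vertices that belong to a finite set defined in `G`
by an existential formula with parameters from `A`. -/
def acl {V : Type} (G : SimpleGraph V) (A : Set V) : Set V :=
  {b | ∃ φ : Language.graph.Formula (A ⊕ Unit),
    φ.IsExistential ∧ (solutions G A φ).Finite ∧ b ∈ solutions G A φ}

/-- The sizes `|acl_G(A)|`, finite or infinite, where `A` is a set of `n` vertices of an
existentially complete graph `G` for `C`. -/
def aclSizes (C : Set FinGraph) (n : ℕ) : Set ℕ∞ :=
  {m | ∃ (V : Type) (G : SimpleGraph V) (A : Set V),
    InE C G ∧ A.encard = n ∧ (acl G A).encard = m}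

/-- The constraint set whose only member is the path of length `k`, which has `k + 1` vertices. -/
def pathConstraint (k : ℕ) : Set FinGraph := {⟨k + 1, SimpleGraph.pathGraph (k + 1)⟩}

/-- `c k n` is the supremum of `|acl_G(A)|` for `|A| = n` and `G` existentially complete for the
path of length `k`. -/
noncomputable def c (k n : ℕ) : ℕ∞ := sSup (aclSizes (pathConstraint k) n)

end CFree

/-
Let `G` be existentially complete for the path of length `k`, let `S` be a finite set of vertices
and let `E` be a component of `G` without `S` that is disjoint from `A`. Suppose that whenever `E`
contains a segment of a path with given ends in `S`, more than `k` components contain such a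
segment of the same length. Then a second copy of `E` can be added to `G`: a path of length `k` in
the larger graph could be rerouted through the other components, into `G`. A vertex `b` of `E` and
its copy satisfy the same existential formulas over `A`, and by existential completeness an
existential formula with finitely many solutions has no solution outside `G`; hence `b` is not
algebraic over `A`. Each of the remaining components meets `A` or contains one of the at most
`|S| (|S| + 2) k` kinds of segments that occur in at most `k` components, so that their number is
bounded. Since a path in `G` has at most `k` vertices, a depth-first search that follows only these
components finds all of `acl A` in at most `k` rounds.

Existentially complete graphs exist because a sufficiently generic ideal of partial graphs decides
every existential statement, and its union is such a graph.
-/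

namespace CFree

section PathLists

variable {V W : Type} {G : SimpleGraph V} {H : SimpleGraph W}

theorem isChain_append_append_iff {α : Type*} {R : α → α → Prop} {l₁ q l₂ : List α} :
    (l₁ ++ q ++ l₂).IsChain R ↔
      l₁.IsChain R ∧ (l₁.getLast?.toList ++ q ++ l₂.head?.toList).IsChain R ∧ l₂.IsChain R := by
  rcases l₁.eq_nil_or_concat with rfl | ⟨l₁, a, rfl⟩ <;> rcases l₂ with _ | ⟨b, l₂⟩
  · simp
  · simpa using List.isChain_split
  · simpa using List.isChain_split (l₁ := l₁) (c := a) (l₂ := q)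
  · have hb := List.isChain_split (R := R) (l₁ := l₁ ++ a :: q) (c := b) (l₂ := l₂)
    have ha := List.isChain_split (R := R) (l₁ := l₁) (c := a) (l₂ := q ++ [b])
    simp only [List.append_assoc, List.cons_append] at hb
    simp [hb, ha, and_assoc]

theorem exists_maximal_block {α : Type*} {P : α → Prop} {l : List α} (h : ∃ x ∈ l, P x) :
    ∃ l₁ q l₂, l = l₁ ++ q ++ l₂ ∧ q ≠ [] ∧ (∀ x ∈ q, P x) ∧
      (∀ x ∈ l₁.getLast?, ¬ P x) ∧ ∀ x ∈ l₂.head?, ¬ P x := by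
  classical
  obtain ⟨b, hb⟩ : ∃ b, l.find? (fun x => P x) = some b := by
    simpa [← Option.isSome_iff_exists] using h
  obtain ⟨hPb, l₁, l₂, rfl, hl₁⟩ := List.find?_eq_some_iff_append.1 hb
  refine ⟨l₁, b :: l₂.takeWhile (fun x => P x), l₂.dropWhile (fun x => P x), ?_,
    List.cons_ne_nil _ _, ?_, fun x hx => ?_, fun x hx => ?_⟩
  · simp [List.takeWhile_append_dropWhile]
  · rintro x (_ | ⟨_, hx⟩)
    · simpa using hPb
    · simpa using List.mem_takeWhile_imp hx
  · simpa using hl₁ x (List.mem_of_getLast? hx)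
  · have := List.head?_dropWhile_not (fun x => decide (P x)) l₂
    rw [Option.mem_def.1 hx] at this
    simpa using this

/-- A path of `G`, encoded as the list of its vertices. -/
structure IsPathList (G : SimpleGraph V) (l : List V) : Prop where
  isChain : l.IsChain G.Adj
  nodup : l.Nodup

/-- A nonempty path `q` whose first vertex is adjacent to `s` and whose last vertex is adjacent to
`t`, where each of the two conditions is void if the end in question is `none`. The ends `s` and `t`
are not part of the segment. Segments are the pieces in which a path is rerouted. -/
structure IsSegment (G : SimpleGraph V) (s t : Option V) (q : List V) : Prop where
  ne_nil : q ≠ []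
  isChain : (s.toList ++ q ++ t.toList).IsChain G.Adj
  nodup : q.Nodup

theorem isContained_pathGraph_iff {n : ℕ} :
    (SimpleGraph.pathGraph n).IsContained G ↔ ∃ l : List V, IsPathList G l ∧ l.length = n := by
  constructor
  · rintro ⟨f⟩
    refine ⟨List.ofFn f, ⟨?_, List.nodup_ofFn.2 f.injective⟩, List.length_ofFn⟩
    rw [List.isChain_iff_getElem]
    intro i hi
    simp only [List.getElem_ofFn]
    exact f.toHom.map_adj (by simp [SimpleGraph.pathGraph_adj])
  · rintro ⟨l, ⟨hc, hn⟩, rfl⟩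
    rw [List.isChain_iff_getElem] at hc
    refine ⟨⟨⟨fun i => l[i], ?_⟩, List.nodup_iff_injective_get.1 hn⟩⟩
    rintro ⟨a, ha⟩ ⟨b, hb⟩ hab
    rcases SimpleGraph.pathGraph_adj.1 hab with rfl | rfl
    · exact hc a hb
    · exact (hc b ha).symm

theorem omits_pathConstraint_iff {k : ℕ} :
    Omits G (pathConstraint k) ↔ ∀ l : List V, IsPathList G l → l.length ≠ k + 1 := by
  simp only [Omits, pathConstraint, Set.mem_singleton_iff, forall_eq, isContained_pathGraph_iff,
    not_exists, not_and, ne_eq]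

theorem IsPathList.map {l : List V} (hl : IsPathList G l) (f : G →g H)
    (hf : Set.InjOn f {x | x ∈ l}) : IsPathList H (l.map f) where
  isChain := List.isChain_map_of_isChain f (fun _ _ => f.map_adj) hl.isChain
  nodup := hl.nodup.map_on fun _ hx _ hy => hf hx hy

theorem IsSegment.map {s t : Option V} {q : List V} (hq : IsSegment G s t q) (f : G →g H)
    (hf : Set.InjOn f {x | x ∈ q}) : IsSegment H (s.map f) (t.map f) (q.map f) where
  ne_nil := by simpa using hq.ne_nil
  isChain := by
    simpa [Option.toList_map] using
      List.isChain_map_of_isChain f (fun _ _ => f.map_adj) hq.isChain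
  nodup := hq.nodup.map_on fun _ hx _ hy => hf hx hy

theorem IsSegment.exists_adj_left {s t : Option V} {q : List V} (hq : IsSegment G s t q) {a : V}
    (ha : a ∈ s) : ∃ x ∈ q, G.Adj a x := by
  obtain rfl : s = some a := ha
  obtain ⟨x, q, rfl⟩ := List.exists_cons_of_ne_nil hq.ne_nil
  exact ⟨x, List.mem_cons_self, hq.isChain.rel⟩

theorem IsSegment.exists_adj_right {s t : Option V} {q : List V} (hq : IsSegment G s t q) {a : V}
    (ha : a ∈ t) : ∃ x ∈ q, G.Adj a x := by
  obtain rfl : t = some a := ha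
  obtain ⟨-, -, h⟩ := List.isChain_append.1 hq.isChain
  obtain ⟨x, hx⟩ := Option.ne_none_iff_exists'.1 (mt List.getLast?_eq_none_iff.1 hq.ne_nil)
  exact ⟨x, List.mem_of_getLast? hx, (h x (by simp [hx]) a (by simp)).symm⟩

theorem IsPathList.isSegment {l₁ q l₂ : List V} (hl : IsPathList G (l₁ ++ q ++ l₂)) (hq : q ≠ []) :
    IsSegment G l₁.getLast? l₂.head? q where
  ne_nil := hq
  isChain := (isChain_append_append_iff.1 hl.isChain).2.1
  nodup := (List.nodup_append.1 (List.nodup_append.1 hl.nodup).1).2.1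

theorem IsPathList.replace {l₁ q q' l₂ : List V} (hl : IsPathList G (l₁ ++ q ++ l₂))
    (hq' : IsSegment G l₁.getLast? l₂.head? q') (hdisj : q'.Disjoint (l₁ ++ l₂)) :
    IsPathList G (l₁ ++ q' ++ l₂) where
  isChain := by
    obtain ⟨h₁, -, h₂⟩ := isChain_append_append_iff.1 hl.isChain
    exact isChain_append_append_iff.2 ⟨h₁, hq'.isChain, h₂⟩
  nodup := by
    have hperm (r : List V) : (l₁ ++ r ++ l₂).Perm (r ++ (l₁ ++ l₂)) := by
      simpa using List.perm_append_comm_assoc l₁ r l₂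
    have := (hperm q).nodup_iff.1 hl.nodup
    exact (hperm q').nodup_iff.2 (hq'.nodup.append this.of_append_right hdisj)

/-- Every segment in `E` of at most `k` vertices that has an end, its ends being outside `E`, can be
replaced by one in `D` with the same ends and the same number of vertices, and this even avoiding
`k` given vertices. This is what makes it possible to reroute a path of length `k` around `E`. -/
def IsReplaceable (G : SimpleGraph V) (k : ℕ) (E D : Set V) : Prop :=
  ∀ ⦃s t : Option V⦄ ⦃q : List V⦄, IsSegment G s t q → q.length ≤ k → (∀ x ∈ q, x ∈ E) →
    (∀ a ∈ s, a ∉ E) → (∀ a ∈ t, a ∉ E) → (s, t) ≠ (none, none) →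
      ∀ X : List V, X.length ≤ k → ∃ q', IsSegment G s t q' ∧ q'.length = q.length ∧
        (∀ x ∈ q', x ∈ D) ∧ q'.Disjoint X

theorem IsReplaceable.exists_isPathList {k : ℕ} {E : Set V} (hE : IsReplaceable G k E Eᶜ)
    {l : List V} (hl : IsPathList G l) (hlen : l.length ≤ k + 1) (hout : ∃ x ∈ l, x ∉ E) :
    ∃ l', IsPathList G l' ∧ l'.length = l.length ∧ ∀ x ∈ l', x ∉ E := by
  classical
  induction hn : l.countP (· ∈ E) using Nat.strong_induction_on generalizing l with | _ n ih
  by_cases hin : ∃ x ∈ l, x ∈ E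
  swap
  · exact ⟨l, hl, rfl, by simpa using hin⟩
  obtain ⟨l₁, q, l₂, rfl, hq, hqE, hl₁, hl₂⟩ := exists_maximal_block hin
  have hqpos := List.length_pos_of_ne_nil hq
  have hends : (l₁.getLast?, l₂.head?) ≠ (none, none) := by
    simp only [ne_eq, Prod.mk.injEq, List.getLast?_eq_none_iff, List.head?_eq_none_iff]
    rintro ⟨rfl, rfl⟩
    obtain ⟨x, hx, hxE⟩ := hout
    exact hxE (hqE x (by simpa using hx))
  have hpos : 0 < (l₁ ++ l₂).length := by
    rw [List.length_pos_iff]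
    rintro h
    simp_all
  simp only [List.length_append] at hlen hpos
  obtain ⟨q', hq', hq'len, hq'E, hdisj⟩ := hE (hl.isSegment hq) (by omega) hqE hl₁ hl₂ hends
    (l₁ ++ l₂) (by rw [List.length_append]; omega)
  have hcount : q.countP (· ∈ E) = q.length := by simpa [List.countP_eq_length] using hqE
  have hcount' : q'.countP (· ∈ E) = 0 := by simpa [List.countP_eq_zero] using hq'E
  obtain ⟨y, hy⟩ := List.exists_mem_of_ne_nil _ hq'.ne_nil
  obtain ⟨l', hl', hl'len, hl'E⟩ := ih _ (by simp only [List.countP_append] at hn ⊢; omega)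
    (hl.replace hq' hdisj) (by simp only [List.length_append]; omega)
    ⟨y, by simp [hy], hq'E y hy⟩ rfl
  exact ⟨l', hl', by simp [hl'len, hq'len], hl'E⟩

end PathLists

section Doubling

variable {V : Type} {G : SimpleGraph V} {E : Set V}

/-- The graph obtained from `G` by adding a second copy of `E`, attached to the complement of `E`
in the same way as `E`, with no edges between the two copies. The second copy is the right summand
of the vertex set. -/
def doubling (G : SimpleGraph V) (E : Set V) : SimpleGraph (V ⊕ E) where
  Adj
    | .inl x, .inl y => G.Adj x y
    | .inl x, .inr y => G.Adj x y ∧ x ∉ E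
    | .inr x, .inl y => G.Adj x y ∧ y ∉ E
    | .inr x, .inr y => G.Adj x y
  symm := ⟨by
    rintro (x | x) (y | y) h
    exacts [h.symm, ⟨h.1.symm, h.2⟩, ⟨h.1.symm, h.2⟩, h.symm]⟩
  loopless := ⟨by rintro (x | x) h <;> exact G.irrefl h⟩

/-- The original graph inside the doubling. -/
def doublingInl (G : SimpleGraph V) (E : Set V) : G ↪g doubling G E where
  toFun := Sum.inl
  inj' := Sum.inl_injective
  map_rel_iff' := Iff.rfl

open Classical in
/-- The embedding of a graph into its doubling that moves `E` to the second copy. -/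
noncomputable def doublingInr (G : SimpleGraph V) (E : Set V) : G ↪g doubling G E where
  toFun x := if h : x ∈ E then Sum.inr ⟨x, h⟩ else Sum.inl x
  inj' x y h := by
    dsimp only at h
    split_ifs at h <;> simp_all
  map_rel_iff' {x y} := by
    change (doubling G E).Adj (if h : x ∈ E then Sum.inr ⟨x, h⟩ else Sum.inl x)
      (if h : y ∈ E then Sum.inr ⟨y, h⟩ else Sum.inl y) ↔ _
    split_ifs with hx hy hy <;> simp [doubling, *]

theorem doublingInr_of_mem {x : V} (hx : x ∈ E) : doublingInr G E x = Sum.inr ⟨x, hx⟩ :=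
  dif_pos hx

theorem doublingInr_of_notMem {x : V} (hx : x ∉ E) : doublingInr G E x = Sum.inl x :=
  dif_neg hx

/-- The projection of the doubling to the original graph that identifies the two copies. -/
def doublingFold (G : SimpleGraph V) (E : Set V) : doubling G E →g G where
  toFun := Sum.elim id Subtype.val
  map_rel' := by
    rintro (x | x) (y | y) h
    exacts [h, h.1, h.1, h]

theorem injOn_doublingFold_range_inr : Set.InjOn (doublingFold G E) (Set.range Sum.inr) := by
  rintro _ ⟨x, rfl⟩ _ ⟨y, rfl⟩ h
  exact congrArg Sum.inr (Subtype.ext h)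

theorem doublingInl_doublingFold {w : V ⊕ E} (hw : w ∉ Set.range Sum.inr) :
    doublingInl G E (doublingFold G E w) = w := by
  rcases w with x | x
  · rfl
  · exact absurd ⟨x, rfl⟩ hw

theorem doublingFold_notMem {w w' : V ⊕ E} (hw : w ∉ Set.range Sum.inr)
    (hw' : w' ∈ Set.range Sum.inr) (h : (doubling G E).Adj w w') : doublingFold G E w ∉ E := by
  obtain ⟨y, rfl⟩ := hw'
  rcases w with x | x
  · exact h.2
  · exact absurd ⟨x, rfl⟩ hw

theorem IsReplaceable.doubling {k : ℕ} (hE : IsReplaceable G k E Set.univ) :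
    IsReplaceable (doubling G E) k (Set.range Sum.inr) (Set.range Sum.inr)ᶜ := by
  intro s t q hq hqk hqE hs ht hst X hX
  have hfold {o : Option (V ⊕ E)} (ho : ∀ a ∈ o, a ∉ Set.range Sum.inr) :
      (o.map (doublingFold G E)).map (doublingInl G E).toHom = o := by
    rcases o with _ | a
    · rfl
    · exact congrArg some (doublingInl_doublingFold (ho a rfl))
  have hends {o : Option (V ⊕ E)} (ho : ∀ a ∈ o, a ∉ Set.range Sum.inr)
      (hadj : ∀ a ∈ o, ∃ x ∈ q, (CFree.doubling G E).Adj a x) :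
      ∀ a ∈ o.map (doublingFold G E), a ∉ E := by
    simp only [Option.mem_map, forall_exists_index, and_imp, forall_apply_eq_imp_iff₂]
    intro a ha
    obtain ⟨x, hx, hax⟩ := hadj a ha
    exact doublingFold_notMem (ho a ha) (hqE x hx) hax
  have hqG := hq.map (doublingFold G E) (injOn_doublingFold_range_inr.mono hqE)
  obtain ⟨q', hq', hlen, -, hdisj⟩ := hE hqG (by simpa using hqk)
    (by rintro _ hx
        obtain ⟨w, hw, rfl⟩ := List.mem_map.1 hx
        obtain ⟨y, rfl⟩ := hqE w hw
        exact y.2)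
    (hends hs fun _ => hq.exists_adj_left) (hends ht fun _ => hq.exists_adj_right)
    (by simpa using hst) (X.map (doublingFold G E)) (by simpa using hX)
  refine ⟨q'.map (doublingInl G E).toHom, ?_, by simpa using hlen, ?_, ?_⟩
  · simpa only [hfold hs, hfold ht] using
      hq'.map (doublingInl G E).toHom (doublingInl G E).injective.injOn
  · simp [doublingInl]
  · simp only [List.disjoint_left, List.forall_mem_map]
    exact fun x hx hxX => hdisj hx (List.mem_map.2 ⟨_, hxX, rfl⟩)

theorem Omits.doubling {k : ℕ} (hG : Omits G (pathConstraint k))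
    (hE : IsReplaceable G k E Set.univ) : Omits (doubling G E) (pathConstraint k) := by
  rw [omits_pathConstraint_iff] at hG ⊢
  intro l hl hlen
  by_cases hin : ∀ x ∈ l, x ∈ Set.range Sum.inr
  · exact hG _ (hl.map (doublingFold G E) (injOn_doublingFold_range_inr.mono hin)) (by simpa)
  · push Not at hin
    obtain ⟨l', hl', hlen', hl'E⟩ := hE.doubling.exists_isPathList hl hlen.le hin
    have hinj : Set.InjOn (doublingFold G E) {x | x ∈ l'} :=
      Set.LeftInvOn.injOn (f₁' := doublingInl G E) fun x hx => doublingInl_doublingFold (hl'E x hx)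
    exact hG _ (hl'.map (doublingFold G E) hinj) (by simp [hlen', hlen])

end Doubling

section Formulas

open Language BoundedFormula

variable {V W : Type} {G : SimpleGraph V} {H : SimpleGraph W} {C : Set FinGraph}

/-- An embedding of graphs as an embedding of first-order structures. -/
def toLanguageEmbedding (f : G ↪g H) :
    @Language.Embedding Language.graph V W G.structure H.structure :=
  let := G.structure
  let := H.structure
  { toFun := f
    inj' := f.injective
    map_fun' := fun f => isEmptyElim f
    map_rel' := by
      rintro n ⟨⟩ x
      exact f.map_rel_iff }

theorem Holds.map (f : G ↪g H) {α : Type} {φ : Language.graph.Formula α} (hφ : φ.IsExistential)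
    {v : α → V} (h : Holds G φ v) : Holds H φ (f ∘ v) := by
  let := G.structure
  let := H.structure
  have := hφ.realize_embedding (toLanguageEmbedding f) h
  rwa [Subsingleton.elim (toLanguageEmbedding f ∘ default) default] at this

theorem isQF_iInf {L : Language} {α ι : Type*} {n : ℕ} [Finite ι] {θ : ι → L.BoundedFormula α n}
    (hθ : ∀ i, (θ i).IsQF) : (BoundedFormula.iInf θ).IsQF := by
  suffices ∀ l : List ι, ((l.map θ).foldr (· ⊓ ·) ⊤).IsQF from this _
  intro l
  induction l with
  | nil => exact IsQF.top
  | cons i l ih => exact (hθ i).inf ih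

theorem isExistential_relabel {L : Language} {α β : Type*} {m n : ℕ} {φ : L.BoundedFormula α m}
    (hφ : φ.IsExistential) (g : α → β ⊕ Fin n) : (φ.relabel g).IsExistential := by
  induction hφ with
  | of_isQF h => exact (h.relabel g).isExistential
  | ex _ ih =>
    rw [relabel_ex]
    exact ih.ex

theorem isQF_restrictFreeVar {L : Language} {α β : Type*} [DecidableEq α] {n : ℕ}
    {φ : L.BoundedFormula α n} (hφ : φ.IsQF) (f : φ.freeVarFinset → β) :
    (φ.restrictFreeVar f).IsQF := by
  induction hφ with
  | falsum => exact IsQF.falsum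
  | of_isAtomic h =>
    cases h with
    | equal t₁ t₂ => exact (IsAtomic.equal _ _).isQF
    | rel R ts => exact (IsAtomic.rel _ _).isQF
  | imp _ _ ih₁ ih₂ => exact (ih₁ _).imp (ih₂ _)

theorem isExistential_restrictFreeVar {L : Language} {α β : Type*} [DecidableEq α] {n : ℕ}
    {φ : L.BoundedFormula α n} (hφ : φ.IsExistential) (f : φ.freeVarFinset → β) :
    (φ.restrictFreeVar f).IsExistential := by
  induction hφ with
  | of_isQF h => exact (isQF_restrictFreeVar h f).isExistential
  | @ex n φ _ ih => exact (ih fun x => f ⟨x, by simp⟩).ex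

theorem exists_isExistential_inf {L : Language} {α : Type*} {n : ℕ} {φ θ : L.BoundedFormula α n}
    (hφ : φ.IsExistential) (hθ : θ.IsQF) :
    ∃ χ : L.BoundedFormula α n, χ.IsExistential ∧ ∀ (M : Type*) [L.Structure M] (v : α → M)
      (xs : Fin n → M), χ.Realize v xs ↔ φ.Realize v xs ∧ θ.Realize v xs := by
  induction hφ with
  | of_isQF h => exact ⟨_ ⊓ θ, (h.inf hθ).isExistential, fun M _ v xs => realize_inf⟩
  | @ex n φ _ ih =>
    obtain ⟨χ, hχ, h⟩ := ih (θ := θ.liftAt 1 n) hθ.liftAt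
    refine ⟨χ.ex, hχ.ex, fun M _ v xs => ?_⟩
    simp [h, realize_liftAt_one_self]

theorem exists_isExistential_exists_notMem {α β : Type} {φ : Language.graph.Formula (α ⊕ Unit)}
    (hφ : φ.IsExistential) (g : α → β) {F : Set β} (hF : F.Finite) :
    ∃ χ : Language.graph.Formula β, χ.IsExistential ∧
      ∀ (V : Type) (G : SimpleGraph V) (v : β → V),
        Holds G χ v ↔ ∃ x, Holds G φ (Sum.elim (v ∘ g) fun _ => x) ∧ x ∉ v '' F := by
  have := hF.to_subtype
  let θ (c : F) : Language.graph.BoundedFormula β 1 :=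
    ∼(Term.bdEqual (Term.var (Sum.inr 0)) (Term.var (Sum.inl c)))
  obtain ⟨χ, hχ, h⟩ := exists_isExistential_inf
    (isExistential_relabel hφ (Sum.map g fun _ => (0 : Fin 1)))
    (isQF_iInf (θ := θ) fun c => (IsAtomic.equal _ _).isQF.not)
  refine ⟨χ.ex, hχ.ex, fun V G v => ?_⟩
  let := G.structure
  unfold Holds Formula.Realize
  rw [realize_ex]
  refine exists_congr fun x => ?_
  rw [h, realize_relabel, realize_iInf]
  refine and_congr (Eq.to_iff ?_) ?_
  · congr 1
    · ext (i | i) <;> simp; rfl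
    · exact Subsingleton.elim _ _
  · simp [θ, Fin.snoc, eq_comm]

theorem solution_mem_range (hG : InE C G) (hH : InG C H) (f : G ↪g H) {A : Set V}
    {φ : Language.graph.Formula (A ⊕ Unit)} (hφ : φ.IsExistential)
    (hfin : (solutions G A φ).Finite) {w : W}
    (hw : Holds H φ (Sum.elim (fun a : A => f a) (fun _ => w))) : w ∈ Set.range f := by
  obtain ⟨χ, hχ, h⟩ := exists_isExistential_exists_notMem hφ Subtype.val hfin
  by_contra hwf
  have hχH : Holds H χ f := (h W H f).2 ⟨w, hw, fun hw' => hwf (Set.image_subset_range f _ hw')⟩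
  obtain ⟨x, hx, hxs⟩ := (h V G id).1 (hG.2 W H f hH χ hχ hχH)
  exact hxs ⟨x, hx, rfl⟩

theorem notMem_acl_of_doubling (hG : InE C G) {E : Set V} (hE : Omits (doubling G E) C) {A : Set V}
    (hA : Disjoint A E) {b : V} (hb : b ∈ E) : b ∉ acl G A := by
  rintro ⟨φ, hφ, hfin, hbs⟩
  have := hG.1.1
  have h := Holds.map (doublingInr G E) hφ hbs
  have hval : doublingInr G E ∘ Sum.elim (fun a : A => (a : V)) (fun _ : Unit => b) =
      Sum.elim (fun a : A => doublingInl G E a) (fun _ => Sum.inr ⟨b, hb⟩) := by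
    ext (a | _)
    · exact doublingInr_of_notMem (Set.disjoint_left.1 hA a.2)
    · exact doublingInr_of_mem hb
  rw [hval] at h
  obtain ⟨x, hx⟩ := solution_mem_range hG ⟨inferInstance, hE⟩ (doublingInl G E) hφ hfin h
  cases hx

end Formulas

section Components

open SimpleGraph

variable {V : Type} {G : SimpleGraph V} {k : ℕ}

/-- The components of `G` without `S` that contain a vertex of `B`. -/
def componentsMeeting (G : SimpleGraph V) (S B : Set V) : Set (G.ComponentCompl S) :=
  {K | ((K : Set V) ∩ B).Nonempty}

/-- The components of `G` without `S` that contain a segment with the ends `τ.1` and with `τ.2`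
vertices. -/
def realizers (G : SimpleGraph V) (S : Set V) (τ : (Option V × Option V) × ℕ) :
    Set (G.ComponentCompl S) :=
  {K | ∃ q, IsSegment G τ.1.1 τ.1.2 q ∧ q.length = τ.2 ∧ ∀ x ∈ q, x ∈ K}

/-- The types of the segments with at most `k` vertices that have an end, all their ends being in
`S`. A type consists of the two optional ends and the number of vertices. -/
def segmentTypes [DecidableEq V] (S : Finset V) (k : ℕ) : Finset ((Option V × Option V) × ℕ) :=
  ((S.insertNone ×ˢ S.insertNone).erase (none, none)) ×ˢ Finset.Icc 1 k

theorem card_segmentTypes [DecidableEq V] (S : Finset V) (k : ℕ) :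
    (segmentTypes S k).card = S.card * (S.card + 2) * k := by
  have : (S.card + 1) * (S.card + 1) - 1 = S.card * (S.card + 2) := by
    rw [show (S.card + 1) * (S.card + 1) = S.card * (S.card + 2) + 1 by ring, Nat.add_sub_cancel]
  simp [segmentTypes, Finset.card_erase_of_mem, this]

theorem encard_biUnion_le {ι α : Type*} {s : Set ι} {f : ι → Set α} {m n : ℕ}
    (hs : s.encard ≤ m) (hf : ∀ i ∈ s, (f i).encard ≤ n) :
    (⋃ i ∈ s, f i).encard ≤ (m * n : ℕ) := by
  lift s to Finset ι using Set.finite_of_encard_le_coe hs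
  rw [Set.encard_coe_eq_coe_finsetCard, Nat.cast_le] at hs
  calc (⋃ i ∈ s, f i).encard ≤ ∑ i ∈ s, (f i).encard := s.set_encard_biUnion_le f
    _ ≤ ∑ _i ∈ s, (n : ℕ∞) := Finset.sum_le_sum hf
    _ ≤ (m * n : ℕ) := by
      rw [Finset.sum_const, nsmul_eq_mul]
      exact_mod_cast Nat.mul_le_mul_right n hs

theorem encard_componentsMeeting_le (S B : Set V) :
    (componentsMeeting G S B).encard ≤ B.encard := by
  choose f hfK hfB using fun K : componentsMeeting G S B => K.2
  refine Function.Embedding.encard_le ⟨fun K => ⟨f K, hfB K⟩, fun K L hKL => Subtype.ext ?_⟩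
  have hfKL : f K = f L := congrArg Subtype.val hKL
  by_contra hne
  exact Set.disjoint_left.1 (ComponentCompl.pairwise_disjoint hne) (hfK K) (hfKL ▸ hfK L)

theorem exists_isSegment_disjoint {S : Set V} {τ : (Option V × Option V) × ℕ} {X : List V}
    (hX : X.length < (realizers G S τ).encard) :
    ∃ q, IsSegment G τ.1.1 τ.1.2 q ∧ q.length = τ.2 ∧ q.Disjoint X := by
  classical
  by_contra! h
  refine hX.not_ge (le_trans (Set.encard_le_encard ?_)
    ((encard_componentsMeeting_le S {x | x ∈ X}).trans ?_))
  · rintro K ⟨q, hq, hlen, hqK⟩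
    obtain ⟨x, hxq, hxX⟩ : ∃ x ∈ q, x ∈ X := by
      simpa [List.disjoint_left] using h q hq hlen
    exact ⟨x, hqK x hxq, hxX⟩
  · rw [← List.coe_toFinset, Set.encard_coe_eq_coe_finsetCard]
    exact_mod_cast X.toFinset_card_le

theorem isReplaceable_of_lt_encard_realizers [DecidableEq V] {S : Finset V}
    {K : G.ComponentCompl (S : Set V)}
    (hK : ∀ τ ∈ segmentTypes S k, K ∈ realizers G S τ → k < (realizers G S τ).encard) :
    IsReplaceable G k K Set.univ := by
  intro s t q hq hqk hqK hs ht hst X hX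
  have hend {o : Option V} (ho : ∀ a ∈ o, a ∉ (K : Set V))
      (hadj : ∀ a ∈ o, ∃ x ∈ q, G.Adj a x) : o ∈ S.insertNone := by
    refine Finset.mem_insertNone.2 fun a ha => ?_
    obtain ⟨x, hx, hax⟩ := hadj a ha
    by_contra haS
    exact ho a ha (ComponentCompl.mem_of_adj x a (hqK x hx) haS hax.symm)
  have hτ : ((s, t), q.length) ∈ segmentTypes S k := by
    simp only [segmentTypes, Finset.mem_product, Finset.mem_erase, Finset.mem_Icc]
    exact ⟨⟨hst, hend hs fun _ => hq.exists_adj_left, hend ht fun _ => hq.exists_adj_right⟩,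
      List.length_pos_of_ne_nil hq.ne_nil, hqk⟩
  obtain ⟨q', hq', hlen, hdisj⟩ := exists_isSegment_disjoint (X := X)
    ((Nat.cast_le.2 hX).trans_lt (hK _ hτ ⟨q, hq, rfl, hqK⟩))
  exact ⟨q', hq', hlen, fun _ _ => trivial, hdisj⟩

theorem encard_componentsMeeting_acl_le [DecidableEq V] (hG : InE (pathConstraint k) G)
    (A : Set V) (S : Finset V) :
    (componentsMeeting G S (acl G A)).encard ≤ A.encard + ((segmentTypes S k).card * k : ℕ) := by
  let rare : Set ((Option V × Option V) × ℕ) :=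
    {τ | τ ∈ segmentTypes S k ∧ (realizers G S τ).encard ≤ k}
  have hcover : componentsMeeting G S (acl G A) ⊆
      componentsMeeting G S A ∪ ⋃ τ ∈ rare, realizers G S τ := by
    rintro K ⟨b, hbK, hb⟩
    by_contra hK
    simp only [Set.mem_union, Set.mem_iUnion, not_or, not_exists, componentsMeeting,
      Set.mem_ofPred_eq, Set.not_nonempty_iff_eq_empty, rare, ← Set.disjoint_iff_inter_eq_empty]
      at hK
    have hrepl : IsReplaceable G k K Set.univ := isReplaceable_of_lt_encard_realizers
      fun τ hτ hKτ => lt_of_not_ge fun hle => hK.2 τ ⟨hτ, hle⟩ hKτ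
    exact notMem_acl_of_doubling hG (hG.1.2.doubling hrepl) hK.1.symm hbK hb
  have hrare : rare.encard ≤ (segmentTypes S k).card := by
    rw [← Set.encard_coe_eq_coe_finsetCard]
    exact Set.encard_le_encard fun τ hτ => hτ.1
  calc _ ≤ _ := (Set.encard_le_encard hcover).trans (Set.encard_union_le _ _)
    _ ≤ _ := add_le_add (encard_componentsMeeting_le S A)
      (encard_biUnion_le hrare fun τ hτ => hτ.2)

theorem exists_adj_of_mem_componentCompl {S T : Set V} {x y : V} {K : G.ComponentCompl S}
    (hx : x ∈ K) (hy : y ∈ K) (hxT : x ∈ T) (hT : T ⊆ insert x S) (hyT : y ∉ T) :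
    ∃ z ∈ G.componentComplMk hyT, G.Adj z x := by
  obtain ⟨hxS, hxK⟩ := hx
  obtain ⟨hyS, rfl⟩ := hy
  obtain ⟨w⟩ := ConnectedComponent.exact hxK.symm
  obtain ⟨d, -, ⟨hdT, hd⟩, hd'⟩ := w.exists_boundary_dart
    {z | ∃ h : (z : V) ∉ T, G.componentComplMk h = G.componentComplMk hyT} ⟨hyT, rfl⟩
    fun h => h.1 hxT
  have hadj : G.Adj d.fst d.snd := d.adj
  refine ⟨d.fst, ⟨hdT, hd⟩, ?_⟩
  have hsndT : (d.snd : V) ∈ T := by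
    by_contra h
    exact hd' (ComponentCompl.mem_of_adj (C := G.componentComplMk hyT) _ _ ⟨hdT, hd⟩ h hadj)
  obtain hsnd | hsnd := hT hsndT
  · rwa [hsnd] at hadj
  · exact absurd hsnd d.snd.2

/- Depth-first search: the removed vertices form a path, so the search has depth at most `k`, and at
each step at most `M` of the components that are left meet `B`. -/
theorem encard_inter_componentCompl_le [DecidableEq V] {M : ℕ} {B : Set V}
    (hG : Omits G (pathConstraint k))
    (hB : ∀ S : Finset V, S.card ≤ k → (componentsMeeting G S B).encard ≤ M) {n : ℕ} {x : V}
    {l : List V} (hl : IsPathList G (x :: l)) (hn : l.length + n = k)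
    {K : G.ComponentCompl (l.toFinset : Set V)} (hx : x ∈ K) :
    (B ∩ K).encard ≤ (∑ i ∈ Finset.range n, M ^ i : ℕ) := by
  induction n generalizing x l with
  | zero => exact absurd (by simpa using hn) (omits_pathConstraint_iff.1 hG _ hl)
  | succ n ih =>
    let T : Finset V := (x :: l).toFinset
    let near : Set (G.ComponentCompl (T : Set V)) := {L | ∃ z ∈ L, G.Adj z x}
    have hcover : B ∩ K ⊆ {x} ∪ ⋃ L ∈ componentsMeeting G T B ∩ near, B ∩ (L : Set V) := by
      rintro y ⟨hyB, hyK⟩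
      refine or_iff_not_imp_left.2 fun hyx => ?_
      have hyl : y ∉ l.toFinset := ComponentCompl.notMem_of_mem hyK
      have hyT : y ∉ (T : Set V) := by simp_all [T]
      have hyL := G.componentComplMk_mem hyT
      refine Set.mem_biUnion ⟨⟨y, hyL, hyB⟩, ?_⟩ ⟨hyB, hyL⟩
      exact exists_adj_of_mem_componentCompl hx hyK (by simp [T]) (by simp [T]) hyT
    have hstep : ∀ L ∈ componentsMeeting G T B ∩ near,
        (B ∩ (L : Set V)).encard ≤ (∑ i ∈ Finset.range n, M ^ i : ℕ) := by
      rintro L ⟨-, z, hz, hzx⟩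
      have hzT : z ∉ T := ComponentCompl.notMem_of_mem hz
      exact ih ⟨hl.isChain.cons_cons hzx, hl.nodup.cons (by simpa [T] using hzT)⟩
        (by simp only [List.length_cons]; omega) hz
    have hcomp : (componentsMeeting G T B ∩ near).encard ≤ M := by
      refine (Set.encard_le_encard Set.inter_subset_left).trans (hB T ?_)
      exact (List.toFinset_card_le _).trans (by simp only [List.length_cons]; omega)
    calc (B ∩ K).encard ≤ _ := (Set.encard_le_encard hcover).trans (Set.encard_union_le _ _)
      _ ≤ 1 + (M * ∑ i ∈ Finset.range n, M ^ i : ℕ) :=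
        add_le_add (Set.encard_singleton x).le (encard_biUnion_le hcomp hstep)
      _ = (∑ i ∈ Finset.range (n + 1), M ^ i : ℕ) := by
        rw [geom_sum_succ, add_comm]
        push_cast
        rfl

theorem encard_acl_le (hG : InE (pathConstraint k) G) {A : Set V} {n : ℕ} (hA : A.encard ≤ n) :
    (acl G A).encard ≤ (n * ∑ i ∈ Finset.range k, (n + k ^ 3 * (k + 2)) ^ i : ℕ) := by
  classical
  have hcomp (S : Finset V) : (componentsMeeting G S (acl G A)).encard ≤
      (n + S.card * (S.card + 2) * k * k : ℕ) := by
    have := encard_componentsMeeting_acl_le hG A S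
    rw [card_segmentTypes] at this
    exact_mod_cast this.trans (add_le_add_left hA _)
  have hdepth (S : Finset V) (hS : S.card ≤ k) :
      (componentsMeeting G S (acl G A)).encard ≤ (n + k ^ 3 * (k + 2) : ℕ) := by
    refine (hcomp S).trans (Nat.cast_le.2 ?_)
    calc n + S.card * (S.card + 2) * k * k ≤ n + k * (k + 2) * k * k := by gcongr
      _ = n + k ^ 3 * (k + 2) := by ring
  have hroot : (componentsMeeting G ((∅ : Finset V) : Set V) (acl G A)).encard ≤ n := by
    simpa using hcomp ∅
  have hcover : acl G A ⊆
      ⋃ K ∈ componentsMeeting G ((∅ : Finset V) : Set V) (acl G A), acl G A ∩ (K : Set V) := by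
    intro b hb
    have hbK := G.componentComplMk_mem (Finset.notMem_empty b : b ∉ ((∅ : Finset V) : Set V))
    exact Set.mem_biUnion ⟨b, hbK, hb⟩ ⟨hb, hbK⟩
  refine (Set.encard_le_encard hcover).trans (encard_biUnion_le hroot fun K _ => ?_)
  obtain ⟨x, hx⟩ := K.nonempty
  exact encard_inter_componentCompl_le (l := []) hG.1.2 hdepth
    ⟨List.isChain_singleton x, List.nodup_singleton x⟩ (zero_add k) hx

end Components

section Existence

open Language

variable {C : Set FinGraph} {W : Type} {H : SimpleGraph W}

/-- A graph omitting `C` whose vertices are natural numbers, infinitely many of which are unused.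
Only the restriction of `graph` to `verts` matters. -/
structure PartialGraph (C : Set FinGraph) where
  verts : Set ℕ
  infinite_compl : vertsᶜ.Infinite
  graph : SimpleGraph ℕ
  omits : Omits (graph.induce verts) C

namespace PartialGraph

/-- The graph on the used vertices. -/
abbrev toGraph (p : PartialGraph C) : SimpleGraph p.verts := p.graph.induce p.verts

/-- Partial graphs are ordered by being an induced subgraph. -/
instance : Preorder (PartialGraph C) where
  le p q := p.verts ⊆ q.verts ∧
    ∀ a ∈ p.verts, ∀ b ∈ p.verts, p.graph.Adj a b ↔ q.graph.Adj a b
  le_refl _ := ⟨subset_rfl, fun _ _ _ _ => Iff.rfl⟩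
  le_trans _ _ _ hpq hqr := ⟨hpq.1.trans hqr.1, fun a ha b hb =>
    (hpq.2 a ha b hb).trans (hqr.2 a (hpq.1 ha) b (hpq.1 hb))⟩

/-- The formula `φ`, whose parameters are vertices of `p`, holds in `p`. -/
def Satisfies (p : PartialGraph C) {A : Set ℕ} (φ : Language.graph.Formula A) : Prop :=
  ∃ h : A ⊆ p.verts, Holds p.toGraph φ (Set.inclusion h)

end PartialGraph

theorem exists_embedding_extending [Countable W] {S : Set ℕ} (hS : Sᶜ.Infinite) (f : S ↪ W) :
    ∃ e : W ↪ ℕ, (∀ x, e (f x) = x) ∧ (Set.range e)ᶜ.Infinite := by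
  classical
  obtain ⟨g, hg⟩ := exists_injective_nat W
  let i := hS.natEmbedding
  let σ : S ⊕ ↥(Set.range f)ᶜ ≃ W :=
    ((Equiv.ofInjective f f.injective).sumCongr (Equiv.refl _)).trans (Equiv.Set.sumCompl _)
  -- Only even indices are used for the new vertices; the odd ones keep the complement infinite.
  let fill : S ⊕ ↥(Set.range f)ᶜ → ℕ := Sum.elim (↑) fun w => i (2 * g w)
  have hfill : Function.Injective fill := by
    refine Subtype.val_injective.sumElim (fun w w' h => ?_) fun x w h => (i _).2 (h ▸ x.2)
    exact Subtype.ext (hg (by simpa using i.injective (Subtype.ext h)))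
  refine ⟨⟨fill ∘ σ.symm, hfill.comp σ.symm.injective⟩, fun x => ?_, ?_⟩
  · exact congrArg fill (σ.symm_apply_apply (Sum.inl x))
  · refine (Set.infinite_range_of_injective (f := fun n => (i (2 * n + 1) : ℕ)) ?_).mono ?_
    · intro m n h
      simpa using i.injective (Subtype.ext h)
    · rintro _ ⟨n, rfl⟩ ⟨w, hw⟩
      suffices h : ∀ y, fill y ≠ i (2 * n + 1) from h _ hw
      rintro (x | w) h
      · exact (i (2 * n + 1)).2 (h ▸ x.2)
      · have := i.injective (Subtype.ext h)
        omega

theorem PartialGraph.exists_iso [Countable W] (hH : Omits H C) {S : Set ℕ} (hS : Sᶜ.Infinite)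
    (f : S ↪ W) : ∃ (q : PartialGraph C) (e : H ≃g q.toGraph), ∀ x, (e (f x) : ℕ) = x := by
  obtain ⟨e, hef, he⟩ := exists_embedding_extending hS f
  let i : H ≃g (H.map e).induce (Set.range e) :=
    { toEquiv := Equiv.ofInjective e e.injective
      map_rel_iff' := by simp }
  have hq : Omits ((H.map e).induce (Set.range e)) C :=
    fun F hF h => hH F hF (h.trans i.symm.isContained)
  exact ⟨⟨Set.range e, he, H.map e, hq⟩, i, hef⟩

theorem PartialGraph.exists_le_iso (p : PartialGraph C) (hH : InG C H) (f : p.toGraph ↪g H) :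
    ∃ q, p ≤ q ∧ ∃ e : H ≃g q.toGraph, ∀ x, (e (f x) : ℕ) = x := by
  have := hH.1
  obtain ⟨q, e, he⟩ := PartialGraph.exists_iso hH.2 p.infinite_compl f.toEmbedding
  have he : ∀ x, (e (f x) : ℕ) = x := he
  refine ⟨q, ⟨fun a ha => ?_, fun a ha b hb => ?_⟩, e, he⟩
  · have hq := (e (f ⟨a, ha⟩)).2
    rwa [he] at hq
  · have h := e.map_adj_iff (v := f ⟨a, ha⟩) (w := f ⟨b, hb⟩)
    rw [f.map_adj_iff, SimpleGraph.comap_adj, SimpleGraph.comap_adj] at h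
    change q.graph.Adj (e _) (e _) ↔ p.graph.Adj a b at h
    rw [← h, he, he]

section Limit

variable (I : Order.Ideal (PartialGraph C))

/-- The vertices of the union of the partial graphs in `I`. -/
def limitVerts : Set ℕ := ⋃ p ∈ I, p.verts

/-- The union of the partial graphs in `I`. -/
def limit : SimpleGraph (limitVerts I) where
  Adj a b := ∃ p ∈ I, ↑a ∈ p.verts ∧ ↑b ∈ p.verts ∧ p.graph.Adj a b
  symm := ⟨fun _ _ ⟨p, hp, ha, hb, h⟩ => ⟨p, hp, hb, ha, h.symm⟩⟩
  loopless := ⟨fun _ ⟨p, _, _, _, h⟩ => p.graph.irrefl h⟩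

variable {I}

/-- The inclusion of a partial graph in the union. -/
def toLimit {p : PartialGraph C} (hp : p ∈ I) : p.toGraph ↪g limit I where
  toFun := Set.inclusion (Set.subset_biUnion_of_mem (u := PartialGraph.verts) hp)
  inj' := Set.inclusion_injective _
  map_rel_iff' {a b} := by
    refine ⟨fun ⟨q, hq, ha, hb, h⟩ => ?_, fun h => ⟨p, hp, a.2, b.2, h⟩⟩
    obtain ⟨r, -, hpr, hqr⟩ := I.directed p hp q hq
    exact (hpr.2 a a.2 b b.2).2 ((hqr.2 a ha b hb).1 h)

theorem exists_mem_ideal_subset_verts {A : Set ℕ} (hA : A.Finite) (hAI : A ⊆ limitVerts I) :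
    ∃ p ∈ I, A ⊆ p.verts := by
  lift A to Finset ℕ using hA
  have hdir : DirectedOn (fun p q : PartialGraph C => p.verts ⊆ q.verts) (I : Set _) :=
    I.directed.mono' fun _ _ _ _ h => h.1
  exact DirectedOn.exists_mem_subset_of_finset_subset_biUnion I.nonempty hdir hAI

theorem omits_limit : Omits (limit I) C := by
  rintro F hF ⟨f⟩
  obtain ⟨p, hp, hfp⟩ := exists_mem_ideal_subset_verts (I := I)
    (Set.finite_range fun i => (f i : ℕ)) (by rintro _ ⟨i, rfl⟩; exact (f i).2)
  have hf (i) : (f i : ℕ) ∈ p.verts := hfp ⟨i, rfl⟩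
  refine p.omits F hF ⟨⟨⟨fun i => ⟨f i, hf i⟩, fun {i j} h => ?_⟩, fun i j h => ?_⟩⟩
  · exact (toLimit hp).map_adj_iff.1 (f.toHom.map_adj h)
  · exact f.injective (Subtype.ext (congrArg (fun x : p.verts => (x : ℕ)) h))

theorem inE_limit (hI : ∀ (A : Finset ℕ) (φ : Language.graph.Formula (A : Set ℕ)),
      ∃ p ∈ I, p.Satisfies φ ∨ ∀ q, p ≤ q → ¬ q.Satisfies φ) :
    InE C (limit I) := by
  classical
  refine ⟨⟨inferInstance, omits_limit⟩, fun W H f hH φ hφ hφH => ?_⟩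
  let A : Finset ℕ := φ.freeVarFinset.image Subtype.val
  have hAI : (A : Set ℕ) ⊆ limitVerts I := by simp [A]
  let g (x : φ.freeVarFinset) : (A : Set ℕ) := ⟨x, by simp [A]⟩
  let ψ : Language.graph.Formula (A : Set ℕ) := BoundedFormula.restrictFreeVar φ g
  have hψ : ψ.IsExistential := isExistential_restrictFreeVar hφ g
  have hψφ {U : Type} {K : SimpleGraph U} (v : limitVerts I → U) :
      Holds K ψ (v ∘ Set.inclusion hAI) ↔ Holds K φ v :=
    let := K.structure
    BoundedFormula.realize_restrictFreeVar v fun _ => rfl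
  obtain ⟨p, hp, ⟨hA, hpψ⟩ | hforce⟩ := hI A ψ
  · exact (hψφ id).1 (hpψ.map (toLimit hp) hψ)
  · obtain ⟨r, hr, hAr⟩ := exists_mem_ideal_subset_verts A.finite_toSet hAI
    obtain ⟨p', hp', hpp', hrp'⟩ := I.directed p hp r hr
    obtain ⟨q, hp'q, e, he⟩ := p'.exists_le_iso hH (f.comp (toLimit hp'))
    have hAp' : (A : Set ℕ) ⊆ p'.verts := hAr.trans hrp'.1
    have hψq := ((hψφ f).2 hφH).map e.toEmbedding hψ
    refine absurd ⟨hAp'.trans hp'q.1, ?_⟩ (hforce q (hpp'.trans hp'q))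
    convert hψq using 1
    ext a
    exact (he ⟨a, hAp' a.2⟩).symm

end Limit

theorem exists_generic_ideal (p : PartialGraph C) :
    ∃ I : Order.Ideal (PartialGraph C), p ∈ I ∧
      ∀ (A : Finset ℕ) (φ : Language.graph.Formula (A : Set ℕ)),
        ∃ q ∈ I, q.Satisfies φ ∨ ∀ r, q ≤ r → ¬ r.Satisfies φ := by
  let ι := Σ A : Finset ℕ, Language.graph.Formula (A : Set ℕ)
  let _ : Encodable ι := Encodable.ofCountable ι
  let decided (i : ι) : Order.Cofinal (PartialGraph C) :=
    { carrier := {q | q.Satisfies i.2 ∨ ∀ r, q ≤ r → ¬ r.Satisfies i.2}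
      isCofinal := fun q => by
        by_cases h : ∃ r, q ≤ r ∧ r.Satisfies i.2
        · obtain ⟨r, hqr, hr⟩ := h
          exact ⟨r, Or.inl hr, hqr⟩
        · push Not at h
          exact ⟨q, Or.inr h, le_rfl⟩ }
  refine ⟨Order.idealOfCofinals p decided, Order.mem_idealOfCofinals p decided, fun A φ => ?_⟩
  obtain ⟨q, hq, hqI⟩ := Order.cofinal_meets_idealOfCofinals p decided ⟨A, φ⟩
  exact ⟨q, hqI, hq⟩

theorem exists_embedding_inE (hH : InG C H) :
    ∃ (V : Type) (G : SimpleGraph V), InE C G ∧ Nonempty (H ↪g G) := by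
  have := hH.1
  obtain ⟨p, e, -⟩ := PartialGraph.exists_iso hH.2 (S := ∅) (by simpa using Set.infinite_univ)
    ⟨fun x => x.2.elim, fun x => x.2.elim⟩
  obtain ⟨I, hp, hI⟩ := exists_generic_ideal p
  exact ⟨_, limit I, inE_limit hI, ⟨(toLimit hp).comp e.toEmbedding⟩⟩

end Existence

section Size

open SimpleGraph

theorem aclSizes_pathConstraint_nonempty {k : ℕ} (hk : k ≠ 0) (n : ℕ) :
    (aclSizes (pathConstraint k) n).Nonempty := by
  have hbot : Omits (⊥ : SimpleGraph (Fin n)) (pathConstraint k) := by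
    rw [omits_pathConstraint_iff]
    rintro (_ | ⟨x, _ | ⟨y, l⟩⟩) hl hlen
    · simp at hlen
    · simp_all
    · exact hl.isChain.rel
  obtain ⟨V, G, hG, ⟨f⟩⟩ := exists_embedding_inE ⟨inferInstance, hbot⟩
  refine ⟨_, V, G, Set.range f, hG, ?_, rfl⟩
  rw [← Set.image_univ, f.injective.encard_image, Set.encard_univ, ENat.card_eq_coe_fintype_card,
    Fintype.card_fin]

theorem geom_sum_lt_pow {k : ℕ} (hk : 2 ≤ k) :
    ∑ i ∈ Finset.range k, (1 + k ^ 3 * (k + 2)) ^ i < k ^ (3 * k ^ 2) := by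
  have hbase : 2 ≤ 1 + k ^ 3 * (k + 2) := by
    have : 0 < k ^ 3 * (k + 2) := by positivity
    omega
  have hpow : 1 + k ^ 3 * (k + 2) ≤ k ^ 6 := by
    have hcube : k + 3 ≤ k ^ 3 := by nlinarith [Nat.mul_le_mul hk hk]
    calc 1 + k ^ 3 * (k + 2) ≤ k ^ 3 * (k + 3) := by nlinarith [Nat.one_le_pow 3 k (by omega)]
      _ ≤ k ^ 3 * k ^ 3 := Nat.mul_le_mul_left _ hcube
      _ = k ^ 6 := by ring
  calc ∑ i ∈ Finset.range k, (1 + k ^ 3 * (k + 2)) ^ i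
      < (1 + k ^ 3 * (k + 2)) ^ k := Nat.geomSum_lt hbase fun i hi => Finset.mem_range.1 hi
    _ ≤ (k ^ 6) ^ k := Nat.pow_le_pow_left hpow k
    _ = k ^ (6 * k) := (pow_mul k 6 k).symm
    _ ≤ k ^ (3 * k ^ 2) := Nat.pow_le_pow_right (by omega) (by nlinarith)

end Size

end CFree

theorem proposition9_general {k : ℕ} (hk : k ≠ 0) (n : ℕ) :
    IsGreatest (CFree.aclSizes (CFree.pathConstraint k) n) (CFree.c k n) ∧
      CFree.c k n ≤ (n * ∑ i ∈ Finset.range k, (n + k ^ 3 * (k + 2)) ^ i : ℕ) := by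
  have hbound : CFree.c k n ≤ (n * ∑ i ∈ Finset.range k, (n + k ^ 3 * (k + 2)) ^ i : ℕ) := by
    refine sSup_le ?_
    rintro _ ⟨V, G, A, hG, hA, rfl⟩
    exact CFree.encard_acl_le hG hA.le
  have := (CFree.aclSizes_pathConstraint_nonempty hk n).to_subtype
  exact ⟨⟨ENat.sSup_mem_of_nonempty_of_lt_top
    (hbound.trans_lt (ENat.natCast_lt_top _)), fun _ => le_sSup⟩, hbound⟩

theorem proposition9 (k : ℕ) (hk : 2 ≤ k) :
    IsGreatest (CFree.aclSizes (CFree.pathConstraint k) 1) (CFree.c k 1) ∧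
      CFree.c k 1 < (k : ℕ∞) ^ (3 * k ^ 2) := by
  obtain ⟨hmax, hle⟩ := proposition9_general (by omega : k ≠ 0) 1
  exact ⟨hmax, hle.trans_lt (by rw [one_mul]; exact_mod_cast CFree.geom_sum_lt_pow hk)⟩
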